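/- Let $k$ be a field of characteristic zero, let $F\supseteq k$ be an algebraically closed field of countable transcendence degree over $k$, and let $G=G_{F|k}$ be the group of field automorphisms of $F$ over $k$, topologized so that the pointwise stabilizers of finite subsets of $F$ form a base of neighbourhoods of $1$. For a field $L$ with $k\subseteq L\subseteq F$ let $G_{F|L}\subseteq G$ be the subgroup fixing $L$ pointwise. For $R=\mathbb{Z}$ or $R=\mathbb{Q}$ let $\mathcal{S}m_G(R)$ be the category of smooth $R$-linear representations of $G$, i.e. $R$-modules with an $R$-linear action of $G$ such that the stabilizer of every element is open; the objects of $\mathcal{S}m_G(\mathbb{Z})$ are called smooth $G$-modules. This is an abelian category with enough injectives; for a subgroup $U\subseteq G$ let $H^n_{\mathcal{S}m_G(R)}(U,-)$ be the $n$-th right derived functor of the functor of invariants $W\mapsto W^U$ on $\mathcal{S}m_G(R)$. Let $F'$ be a field with $k\subseteq F'\subseteq F$, of infinite transcendence degree over $k$, and let $\overline{F'}$ be the algebraic closure of $F'$ in $F$. Then for every $n>0$: (1) for every smooth $G$-module $W$, $$H^n_{\mathcal{S}m_G(\mathbb{Z})}(G_{F|\overline{F'}},W)=0\quad\text{and}\quad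 H^n_{\mathcal{S}m_G(\mathbb{Z})}(G_{F|F'},W\otimes_{\mathbb{Z}}\mathbb{Q})=0,$$ where $G$ acts trivially on $\mathbb{Q}$; (2) for every smooth $\mathbb{Q}$-linear representation $W$ of $G$, $$H^n_{\mathcal{S}m_G(\mathbb{Q})}(G_{F|\overline{F'}},W)=0\quad\text{and}\quad H^n_{\mathcal{S}m_G(\mathbb{Q})}(G_{F|F'},W)=0.$$ -/

import Mathlib

open CategoryTheory CategoryTheory.Limits
open scoped TensorProduct

universe u v

section SmoothRepresentations

/-- A representation `W` of the group `G = F ≃ₐ[k] F` of field automorphisms of `F` fixing `k` is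
smooth if the stabilizer of each of its vectors is open, where `G` carries the group topology in
which the pointwise stabilizers of the finite subsets of `F` form a base of neighbourhoods of `1`.
In other words, the stabilizer of each vector contains the pointwise stabilizer of a finite subset
of `F`. (This is not Mathlib's Krull topology when `F` is not algebraic over `k`.) -/
def isSmoothRep (R : Type) [CommRing R] (k : Type v) (F : Type u) [Field k] [Field F]
    [Algebra k F] : ObjectProperty (Rep.{u} R (F ≃ₐ[k] F)) :=
  fun W ↦ ∀ w : W.V, ∃ S : Finset F,
    ∀ g ∈ fixingSubgroup (F ≃ₐ[k] F) (S : Set F), W.ρ g w = w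

variable (R : Type) [CommRing R] (k : Type v) (F : Type u) [Field k] [Field F] [Algebra k F]

/-- The category of smooth `R`-linear representations of `F ≃ₐ[k] F` (with trivial action on `R`):
the full subcategory of all `R`-linear representations formed by the smooth ones. For `R = ℤ` this
is the category of smooth `G`-modules. -/
abbrev SmoothRep := (isSmoothRep R k F).FullSubcategory

variable {R k F}

theorem isSmoothRep_of_injective {V W : Rep.{u} R (F ≃ₐ[k] F)} (f : V ⟶ W)
    (hf : Function.Injective f.hom) (hW : isSmoothRep R k F W) : isSmoothRep R k F V := by
  intro v
  obtain ⟨S, hS⟩ := hW (f.hom v)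
  exact ⟨S, fun g hg ↦ hf (by rw [Rep.hom_comm_apply]; exact hS g hg)⟩

theorem isSmoothRep_of_surjective {V W : Rep.{u} R (F ≃ₐ[k] F)} (f : V ⟶ W)
    (hf : Function.Surjective f.hom) (hV : isSmoothRep R k F V) : isSmoothRep R k F W := by
  intro w
  obtain ⟨v, rfl⟩ := hf w
  obtain ⟨S, hS⟩ := hV v
  exact ⟨S, fun g hg ↦ by rw [← Rep.hom_comm_apply, hS g hg]⟩

instance : (isSmoothRep R k F).IsClosedUnderSubobjects where
  prop_of_mono f _ hY := isSmoothRep_of_injective f ((Rep.mono_iff_injective f).1 inferInstance) hY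

instance : (isSmoothRep R k F).IsClosedUnderQuotients where
  prop_of_epi f _ hX := isSmoothRep_of_surjective f ((Rep.epi_iff_surjective f).1 inferInstance) hX

open ZeroObject in
instance : (isSmoothRep R k F).ContainsZero where
  exists_zero := ⟨0, isZero_zero _, fun _ ↦ ⟨∅, fun _ _ ↦
    ((Rep.isZero_iff R (F ≃ₐ[k] F) 0).1 (isZero_zero _)).elim _ _⟩⟩

instance : (isSmoothRep R k F).IsClosedUnderFiniteProducts where
  isClosedUnderLimitsOfShape J _ := by
    refine ⟨?_⟩
    rintro X ⟨p⟩ x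
    classical
    have := Fintype.ofFinite J
    choose S hS using fun j : J ↦ p.prop_diag_obj ⟨j⟩ ((p.π.app ⟨j⟩).hom x)
    refine ⟨Finset.univ.biUnion S, fun g hg ↦ ?_⟩
    have : PreservesLimitsOfSize.{0, 0} (forget₂ (Rep.{u} R (F ≃ₐ[k] F)) (ModuleCat.{u} R)) :=
      preservesLimitsOfSize_shrink.{0, u, 0, u} _
    refine Concrete.isLimit_ext _ (isLimitOfPreserves (forget₂ _ (ModuleCat.{u} R)) p.isLimit)
      _ _ fun ⟨j⟩ ↦ ?_
    refine (Rep.hom_comm_apply (p.π.app ⟨j⟩) g x).trans (hS j g ?_)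
    rw [mem_fixingSubgroup_iff] at hg ⊢
    exact fun y hy ↦ hg y (by simpa using ⟨j, hy⟩)

/-- The smooth part of a representation: the largest smooth subrepresentation. -/
def smoothPart (W : Rep.{u} R (F ≃ₐ[k] F)) : Subrepresentation W.ρ where
  toSubmodule :=
    { carrier := {w | ∃ S : Finset F, ∀ g ∈ fixingSubgroup (F ≃ₐ[k] F) (S : Set F), W.ρ g w = w}
      zero_mem' := ⟨∅, by simp⟩
      add_mem' := by
        classical
        rintro a b ⟨S, hS⟩ ⟨T, hT⟩
        refine ⟨S ∪ T, fun g hg ↦ ?_⟩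
        simp only [mem_fixingSubgroup_iff, Finset.coe_union, Set.mem_union] at hg hS hT
        rw [map_add, hS g fun y hy ↦ hg y (.inl hy), hT g fun y hy ↦ hg y (.inr hy)]
      smul_mem' := by
        rintro c w ⟨S, hS⟩
        exact ⟨S, fun g hg ↦ by rw [map_smul, hS g hg]⟩ }
  apply_mem_toSubmodule := by
    classical
    rintro h w ⟨S, hS⟩
    refine ⟨S.image h, fun g hg ↦ ?_⟩
    have : W.ρ (h⁻¹ * g * h) w = w := hS _ (by
      simp only [mem_fixingSubgroup_iff, Finset.coe_image, Set.mem_image, AlgEquiv.smul_def] at hg ⊢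
      intro y hy
      rw [AlgEquiv.mul_apply, AlgEquiv.mul_apply, hg _ ⟨y, hy, rfl⟩]
      exact h.symm_apply_apply y)
    rw [← Module.End.mul_apply, ← map_mul, show g * h = h * (h⁻¹ * g * h) by group, map_mul,
      Module.End.mul_apply, this]

instance : EnoughInjectives (Rep.{u} R (F ≃ₐ[k] F)) :=
  EnoughInjectives.of_equivalence Rep.equivalenceModuleMonoidAlgebra.functor

instance : EnoughInjectives (SmoothRep R k F) where
  presentation W := by
    let P := isSmoothRep R k F
    have hι : P.ι.PreservesMonomorphisms := P.preservesMonomorphisms_ι_of_isNormalEpiCategory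
    let J : Rep.{u} R (F ≃ₐ[k] F) := Injective.under W.obj
    let j : W.obj ⟶ J := Injective.ι W.obj
    let Js : Rep.{u} R (F ≃ₐ[k] F) := Rep.of (smoothPart J).toRepresentation
    have hJs : P Js := by
      rintro ⟨w, hw⟩
      obtain ⟨S, hS⟩ := hw
      exact ⟨S, fun g hg ↦ Subtype.ext (hS g hg)⟩
    let i : Js ⟶ J := Rep.ofHom ⟨(smoothPart J).toSubmodule.subtype, fun g ↦ rfl⟩
    have lift : ∀ {X : Rep.{u} R (F ≃ₐ[k] F)} (_ : P X) (f : X ⟶ J),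
        ∃ f' : X ⟶ Js, f' ≫ i = f := by
      intro X hX f
      have hm : ∀ x, f.hom.toLinearMap x ∈ (smoothPart J).toSubmodule := fun x ↦ by
        obtain ⟨S, hS⟩ := hX x
        change ∃ S : Finset F, ∀ g ∈ fixingSubgroup (F ≃ₐ[k] F) (S : Set F),
          J.ρ g (f.hom x) = f.hom x
        exact ⟨S, fun g hg ↦ by
          rw [← Rep.hom_comm_apply, hS g hg]⟩
      refine ⟨Rep.ofHom ⟨f.hom.toLinearMap.codRestrict _ hm, fun g ↦ ?_⟩, ?_⟩
      · refine LinearMap.ext fun x ↦ Subtype.ext ?_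
        exact Rep.hom_comm_apply f g x
      · ext x
        rfl
    have hi : Mono i := (Rep.mono_iff_injective i).2 Subtype.val_injective
    obtain ⟨j', hj'⟩ := lift W.property j
    have hj'm : Mono j' := by
      have : Mono (j' ≫ i) := by rw [hj']; infer_instance
      exact mono_of_mono j' i
    refine ⟨{ J := ⟨Js, hJs⟩, injective := ⟨fun {X Y} a m hm ↦ ?_⟩, f := P.homMk j', mono := ?_ }⟩
    · have : Mono m.hom := hι.preserves m
      obtain ⟨b, hb⟩ := lift Y.property (Injective.factorThru (a.hom ≫ i) m.hom)
      refine ⟨P.homMk b, ?_⟩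
      apply P.ι.map_injective
      change m.hom ≫ b = a.hom
      rw [← cancel_mono i, Category.assoc, hb, Injective.comp_factorThru]
    · exact P.ι.mono_of_mono_map hj'm

variable (R) in
/-- The functor `H⁰(H, -)` of invariants of a subgroup `H` of `G = F ≃ₐ[k] F`, defined on the
category of smooth representations of the whole group `G`. -/
noncomputable def smoothInvariants (H : Subgroup (F ≃ₐ[k] F)) :
    SmoothRep R k F ⥤ ModuleCat.{u} R :=
  (isSmoothRep R k F).ι ⋙ Rep.resFunctor H.subtype ⋙ Rep.invariantsFunctor R H

noncomputable instance (H : Subgroup (F ≃ₐ[k] F)) : (smoothInvariants R H).Additive := by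
  unfold smoothInvariants
  infer_instance

variable (R) in
/-- The cohomology `Hⁿ(H, W)` of a subgroup `H` of `G = F ≃ₐ[k] F` with coefficients in a smooth
representation `W` of `G`: the `n`-th right derived functor of `H`-invariants on the category of
smooth representations of `G` (not of `H`). -/
noncomputable def smoothCohomology (H : Subgroup (F ≃ₐ[k] F)) (n : ℕ) :
    SmoothRep R k F ⥤ ModuleCat.{u} R :=
  (smoothInvariants R H).rightDerived n

/-- The smooth representation `W ⊗ M`, where `G` acts trivially on the `R`-module `M`. -/
noncomputable def SmoothRep.tensorTrivial (W : SmoothRep R k F) (M : Type) [AddCommGroup M]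
    [Module R M] : SmoothRep R k F where
  obj := Rep.of (W.obj.ρ.tprod (Representation.trivial R (F ≃ₐ[k] F) M))
  property := fun x ↦ by
    classical
    change ∃ S : Finset F, ∀ g ∈ fixingSubgroup (F ≃ₐ[k] F) (S : Set F),
      TensorProduct.map (W.obj.ρ g) (LinearMap.id : M →ₗ[R] M) x = x
    induction x using TensorProduct.induction_on with
    | zero => exact ⟨∅, by simp⟩
    | tmul w q =>
      obtain ⟨S, hS⟩ := W.property w
      exact ⟨S, fun g hg ↦ by rw [TensorProduct.map_tmul, hS g hg, LinearMap.id_apply]⟩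
    | add a b ha hb =>
      obtain ⟨S, hS⟩ := ha
      obtain ⟨T, hT⟩ := hb
      refine ⟨S ∪ T, fun g hg ↦ ?_⟩
      simp only [mem_fixingSubgroup_iff, Finset.coe_union, Set.mem_union] at hg hS hT
      rw [map_add, hS g fun y hy ↦ hg y (.inl hy), hT g fun y hy ↦ hg y (.inr hy)]

end SmoothRepresentations

/-! ### Extending automorphisms along transcendence bases. -/

section FieldAutomorphisms

open MvPolynomial

/-! Vanishing comes from lifting invariants along a morphism `f : V ⟶ W`. Let `L` be algebraically
closed in `F`, of infinite transcendence degree, and let `f v` be fixed by `G_{F|L}`. By smoothness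
`v` is fixed by `G_{F|S}` with `S` finite, so the stabilizer of `f v` contains `G_{F|L}` and
`G_{F|S}`. By `exists_mem_forall_apply_mem_of_fixingSubgroup_le` it contains some `g` with `g S ⊆
L`. Then `g v` has the same image as `v` and is fixed by `G_{F|gS}`, hence by `G_{F|L}`. So cocycles
of invariants in an injective resolution are coboundaries.

For `F'` not closed, lift first over its algebraic closure. The new lift is fixed by the stabilizer
of a finite set algebraic over `F'`, so its `G_{F|F'}`-orbit is finite and the orbit sum lifts a
nonzero multiple of `f v`. Thus every class of positive degree is torsion, and it is zero when
nonzero integers are invertible on the coefficients. -/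

theorem AlgebraicIndependent.aeval_of_leftInverse {ι R A : Type*} [CommRing R] [CommRing A]
    [Algebra R A] {x : ι → A} (hx : AlgebraicIndependent R x) (φ ψ : ι → MvPolynomial ι R)
    (h : ∀ i, bind₁ ψ (φ i) = X i) :
    AlgebraicIndependent R fun i ↦ aeval x (φ i) := by
  have hc : (bind₁ ψ).comp (bind₁ φ) = AlgHom.id R (MvPolynomial ι R) := by
    ext1 i
    simpa using h i
  refine hx.aeval_of_algebraicIndependent (f := φ) ?_
  exact Function.LeftInverse.injective (g := bind₁ ψ) (DFunLike.congr_fun hc)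

/-- `F` is an algebraic closure of the polynomial ring `K[x]`, so uniqueness of algebraic closures
extends any automorphism of that ring. -/
theorem IsTranscendenceBasis.exists_algEquiv {ι K F : Type*} [Field K] [Field F] [Algebra K F]
    [IsAlgClosed F] {x : ι → F} (hx : IsTranscendenceBasis K x)
    (φ : MvPolynomial ι K ≃ₐ[K] MvPolynomial ι K) :
    ∃ σ : F ≃ₐ[K] F, ∀ i, σ (x i) = aeval x (φ (X i)) := by
  have := IsAlgClosed.isAlgClosure_of_transcendence_basis x hx
  let e : Algebra.adjoin K (Set.range x) ≃ₐ[K] Algebra.adjoin K (Set.range x) :=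
    (hx.1.aevalEquiv.symm.trans φ).trans hx.1.aevalEquiv
  let σ : F ≃+* F := IsAlgClosure.equivOfEquiv F F e.toRingEquiv
  have hσ (a : Algebra.adjoin K (Set.range x)) : σ a = e a :=
    IsAlgClosure.equivOfEquiv_algebraMap F F e.toRingEquiv a
  refine ⟨AlgEquiv.ofRingEquiv (f := σ) fun r ↦ ?_, fun i ↦ ?_⟩
  · have := hσ (algebraMap K _ r)
    rw [e.commutes] at this
    exact this
  · have hX : ((hx.1.aevalEquiv (X i) : Algebra.adjoin K (Set.range x)) : F) = x i :=
      (hx.1.algebraMap_aevalEquiv (X i)).trans (aeval_X x i)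
    have := hσ (hx.1.aevalEquiv (X i))
    rw [hX] at this
    refine this.trans ?_
    simp only [e, AlgEquiv.trans_apply, AlgEquiv.symm_apply_apply]
    exact hx.1.algebraMap_aevalEquiv (φ (X i))

/-- Affine changes of algebraically independent variables extend to automorphisms of an
algebraically closed field. -/
theorem AlgebraicIndependent.exists_algEquiv_affine {ι K F : Type*} [Field K] [Field F]
    [Algebra K F] [IsAlgClosed F] {t : ι → F} (ht : AlgebraicIndependent K t) (e : Kˣ)
    (c : ι → F) (hc : ∀ i, IsAlgebraic K (c i)) :
    ∃ σ : F ≃ₐ[K] F, (∀ a, IsAlgebraic K a → σ a = a) ∧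
      ∀ i, σ (t i) = algebraMap K F e * t i + c i := by
  classical
  -- Over `E` the `c i` become constants, and an `E`-automorphism fixes everything algebraic over
  -- `K`.
  let E := algebraicClosure K F
  have htE : AlgebraicIndependent E t := ht.algebraicClosure
  obtain ⟨B, htB, hB⟩ := exists_isTranscendenceBasis_superset htE.to_subtype_range
  let t' (i : ι) : B := ⟨t i, htB ⟨i, rfl⟩⟩
  have ht' : Function.Injective t' := fun i j hij ↦ htE.injective (congr_arg Subtype.val hij)
  let c' (i : ι) : E := ⟨c i, mem_algebraicClosure_iff.2 (hc i)⟩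
  -- The defaults `1` and `0` leave the basis elements outside `t` unchanged.
  let e₁ : B → Eˣ := Function.extend t' (fun _ ↦ Units.map (algebraMap K E) e) 1
  let c₁ : B → E := Function.extend t' c' 0
  let φ : MvPolynomial B E ≃ₐ[E] MvPolynomial B E := AlgEquiv.ofAlgHom
    (aeval fun b ↦ C (e₁ b : E) * X b + C (c₁ b))
    (aeval fun b ↦ C ((e₁ b)⁻¹ : Eˣ).1 * (X b - C (c₁ b)))
    (by
      ext1 b
      simp only [AlgHom.comp_apply, aeval_X, map_mul, map_sub, AlgHom.id_apply]
      rw [← MvPolynomial.algebraMap_eq, AlgHom.commutes, AlgHom.commutes,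
        MvPolynomial.algebraMap_eq, add_sub_cancel_right, ← mul_assoc, ← C_mul]
      simp)
    (by
      ext1 b
      simp only [AlgHom.comp_apply, aeval_X, map_mul, map_add, AlgHom.id_apply]
      rw [← MvPolynomial.algebraMap_eq, AlgHom.commutes, AlgHom.commutes,
        MvPolynomial.algebraMap_eq, ← mul_assoc, ← C_mul]
      simp)
  obtain ⟨σ, hσ⟩ := hB.exists_algEquiv φ
  refine ⟨σ.restrictScalars K, fun a ha ↦ σ.commutes ⟨a, mem_algebraicClosure_iff.2 ha⟩,
    fun i ↦ (hσ (t' i)).trans ?_⟩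
  have h1 : e₁ (t' i) = Units.map (algebraMap K E) e := ht'.extend_apply _ _ _
  have h2 : c₁ (t' i) = c' i := ht'.extend_apply _ _ _
  have h3 : φ (X (t' i)) = C (e₁ (t' i) : E) * X (t' i) + C (c₁ (t' i)) :=
    aeval_X _ _
  rw [h3, h1, h2]
  simp only [map_add, map_mul, aeval_X, ← MvPolynomial.algebraMap_eq, AlgHom.commutes]
  rfl

theorem IsAlgebraic.algEquiv_apply_of_mapsTo {k F : Type*} [Field k] [Field F] [Algebra k F]
    (g : F ≃ₐ[k] F) {S : Set F} {K : IntermediateField k F} (hS : ∀ a ∈ S, g a ∈ K) {a : F}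
    (ha : IsAlgebraic (Algebra.adjoin k S) a) : IsAlgebraic K (g a) := by
  have hle : Algebra.adjoin k S ≤ K.toSubalgebra.comap g.toAlgHom :=
    Algebra.adjoin_le hS
  let f : Algebra.adjoin k S →+* K :=
    ((g : F →+* F).comp (Algebra.adjoin k S).val.toRingHom).codRestrict K fun x ↦ hle x.2
  refine ha.ringHom_of_comp_eq f (g : F →+* F) (fun x y hxy ↦ ?_) rfl
  exact Subtype.ext (g.injective (congr_arg Subtype.val hxy))

open AlgebraicIndependent

variable {k F : Type*} [Field k] [Field F] [Algebra k F]

theorem AlgebraicIndependent.sumElim_add {ι κ R A : Type*} [CommRing R] [CommRing A]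
    [Algebra R A] {x t : ι → A} {c : κ → A}
    (h : AlgebraicIndependent R (Sum.elim t (Sum.elim x c))) :
    AlgebraicIndependent R (Sum.elim t (Sum.elim (fun i ↦ t i + x i) c)) := by
  convert h.aeval_of_leftInverse
    (Sum.elim (X ∘ Sum.inl)
      (Sum.elim (fun i ↦ X (Sum.inl i) + X (Sum.inr (Sum.inl i))) (X ∘ Sum.inr ∘ Sum.inr)))
    (Sum.elim (X ∘ Sum.inl)
      (Sum.elim (fun i ↦ X (Sum.inr (Sum.inl i)) - X (Sum.inl i)) (X ∘ Sum.inr ∘ Sum.inr)))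
    ?_ using 1
  · ext (i | i | i) <;> simp
  · rintro (i | i | i) <;> simp

/-- In the algebraic independence matroid, extend a basis `B` of `L` to a basis `J` of `L ∪ T` and
put `t = J \ B`. Closure is finitary, so a finite `D ⊆ J` already spans `T`; put `C = D ∩ B`. -/
theorem IntermediateField.exists_transcendence_data (L : IntermediateField k F)
    (hinf : Cardinal.aleph0 ≤ Algebra.trdeg k L) (T : Set F) (hT : T.Finite) :
    ∃ B C t : Set F, AlgebraicIndepOn k id (B ∪ t) ∧ Disjoint B t ∧ B ⊆ L ∧ B.Infinite ∧
      (∀ a ∈ L, IsAlgebraic (Algebra.adjoin k B) a) ∧ C ⊆ B ∧ C.Finite ∧ t.Finite ∧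
      ∀ a ∈ T, IsAlgebraic (Algebra.adjoin k (C ∪ t)) a := by
  have hmem (S : Set F) (a : F) :
      a ∈ (matroid k F).closure S ↔ IsAlgebraic (Algebra.adjoin k S) a := by
    rw [matroid_closure_eq]; rfl
  obtain ⟨b, hb⟩ := exists_isTranscendenceBasis k L
  let B : Set F := L.val '' b
  have hBL : B ⊆ L := by
    rintro _ ⟨y, -, rfl⟩
    exact y.2
  have hBi : ∀ a ∈ L, IsAlgebraic (Algebra.adjoin k B) a := fun a ha ↦ by
    let f : Algebra.adjoin k b →+* Algebra.adjoin k B :=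
      (L.val.toRingHom.comp (Algebra.adjoin k b).val.toRingHom).codRestrict _ fun y ↦ by
        have := (Subalgebra.mem_map (f := L.val)).2 ⟨y, y.2, rfl⟩
        rwa [AlgHom.map_adjoin] at this
    have halg := hb.isAlgebraic
    rw [Subtype.range_coe] at halg
    exact (halg.1 ⟨a, ha⟩).ringHom_of_comp_eq f L.val
      (fun x y hxy ↦ Subtype.ext (Subtype.ext
        (show ((x : L) : F) = (y : L) from congr_arg
          (fun z : Algebra.adjoin k B ↦ (z : F)) hxy))) rfl
  have hB : (matroid k F).IsBasis B L :=
    matroid_isBasis_iff.2 ⟨AlgebraicIndependent.image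
      (hb.1.map' (f := L.val) Subtype.val_injective), hBL, hBi⟩
  have hBinf : B.Infinite := by
    refine Set.Infinite.image Subtype.val_injective.injOn ?_
    rw [← Set.infinite_coe_iff, ← Cardinal.aleph0_le_mk_iff, hb.cardinalMk_eq_trdeg]
    exact hinf
  obtain ⟨J, hJ, hBJ⟩ := hB.indep.subset_isBasis_of_subset
    (hB.subset.trans (Set.subset_union_left (t := T)))
  have hJi := matroid_isBasis_iff.1 hJ
  obtain ⟨D, hDJ, hD, -, hTD⟩ := (matroid k F).exists_subset_finite_closure_of_subset_closure
    (X := T) (Y := J) hT fun a ha ↦ (hmem _ _).2 (hJi.2.2 a (.inr ha))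
  refine ⟨B, D ∩ B, J \ B, ?_, Set.disjoint_sdiff_right, hBL, hBinf, hBi,
    Set.inter_subset_right, hD.inter_of_left _, ?_, fun a ha ↦ ?_⟩
  · rw [Set.union_sdiff_cancel hBJ]
    exact hJi.1
  -- `t` is finite because it lies in `T`: an element of `t` in `L` would depend on `B`,
  -- contradicting independence of `J`.
  · refine hT.subset fun a ha ↦ (hJ.subset ha.1).resolve_left fun haL ↦ ?_
    have hsub : B ⊆ J \ {a} := fun b hb ↦ ⟨hBJ hb, fun h ↦ ha.2 (h ▸ hb)⟩
    exact hJ.indep.notMem_closure_sdiff_of_mem ha.1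
      ((matroid k F).closure_subset_closure hsub ((hmem _ _).2 (hBi a haL)))
  · have hsub : D ⊆ D ∩ B ∪ J \ B := fun b hb ↦ by
      by_cases hbB : b ∈ B
      · exact .inl ⟨hb, hbB⟩
      · exact .inr ⟨hDJ hb, hbB⟩
    exact (hmem _ _).1 ((matroid k F).closure_subset_closure hsub (hTD ha))

/-- A subgroup containing the pointwise stabilizers of a finite set `T` and of an algebraically
closed subfield `L` of infinite transcendence degree contains an automorphism moving `T` into `L`.

If `t` is a transcendence basis of `T` over `L` and `x` are independent elements of `L`, conjugate
the stabilizer of `T` by `t ↦ t + x` to obtain the automorphism exchanging `t` and `x`, which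
fixes `t + x`. -/
theorem exists_mem_forall_apply_mem_of_fixingSubgroup_le [IsAlgClosed F]
    (L : IntermediateField k F)
    (hL : ∀ a : F, IsAlgebraic L a → a ∈ L) (hinf : Cardinal.aleph0 ≤ Algebra.trdeg k L)
    (T : Set F) (hT : T.Finite) (H : Subgroup (F ≃ₐ[k] F)) (hLH : L.fixingSubgroup ≤ H)
    (hTH : fixingSubgroup (F ≃ₐ[k] F) T ≤ H) : ∃ g ∈ H, ∀ a ∈ T, g a ∈ L := by
  obtain ⟨B, C, t, hind, hdisj, hBL, hB, hLB, hCB, hC, ht, hTC⟩ :=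
    L.exists_transcendence_data hinf T hT
  have := ht.to_subtype
  have := (hB.sdiff hC).to_subtype
  -- Infinite transcendence degree leaves room for `x`; avoiding `C` keeps `t`, `x`, `C` jointly
  -- independent.
  obtain ⟨x⟩ : Nonempty (t ↪ (B \ C : Set F)) := by
    have := Fintype.ofFinite t
    exact ⟨(Fintype.equivFin t).toEmbedding.trans
      (Fin.valEmbedding.trans (Infinite.natEmbedding _))⟩
  have hind' {κ : Type _} (f : κ → F) (hf : Function.Injective f) (hfJ : ∀ i, f i ∈ B ∪ t) :
      AlgebraicIndependent k f :=
    hind.comp (fun i ↦ ⟨f i, hfJ i⟩) fun i j hij ↦ hf (congr_arg Subtype.val hij)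
  have hxB (i : t) : (x i : F) ∈ B := (x i).2.1
  have hxC (i : t) : (x i : F) ∉ C := (x i).2.2
  have htB (i : t) : (i : F) ∉ B := fun h ↦ hdisj.le_bot ⟨h, i.2⟩
  have h1 : AlgebraicIndependent k (Sum.elim ((↑) : t → F) ((↑) : B → F)) := by
    refine hind' _ (Function.Injective.sumElim Subtype.val_injective Subtype.val_injective
      fun i b h ↦ htB i (h ▸ b.2)) ?_
    rintro (i | b)
    exacts [.inr i.2, .inl b.2]
  have h2 : AlgebraicIndependent k
      (Sum.elim ((↑) : t → F) (Sum.elim (fun i ↦ (x i : F)) ((↑) : C → F))) := by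
    refine hind' _ (Subtype.val_injective.sumElim
      ((Subtype.val_injective.comp x.injective).sumElim Subtype.val_injective
        fun i c (h : (x i : F) = c) ↦ hxC i (h ▸ c.2)) ?_) ?_
    · rintro i (j | c) h
      · exact htB i (h ▸ hxB j)
      · exact htB i (h ▸ hCB c.2)
    · rintro (i | i | c)
      exacts [.inr i.2, .inl (hxB i), .inl (hCB c.2)]
  let s (i : t) : F := i + x i
  let K := IntermediateField.adjoin k (Set.range (Sum.elim s ((↑) : C → F)))
  have htB' : AlgebraicIndependent (IntermediateField.adjoin k B) ((↑) : t → F) := by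
    have := (sumElim_iff.1 h1).2
    rw [Subtype.range_coe] at this
    exact IntermediateField.algebraicIndependent_adjoin_iff.2 this
  have htK : AlgebraicIndependent K ((↑) : t → F) :=
    IntermediateField.algebraicIndependent_adjoin_iff.2 (sumElim_iff.1 h2.sumElim_add).2
  have hxL (i : t) : (x i : F) ∈ L := hBL (hxB i)
  have hsK (i : t) : s i ∈ K := IntermediateField.subset_adjoin _ _ ⟨.inl i, rfl⟩
  have hCK (c : F) (hc : c ∈ C) : c ∈ K := IntermediateField.subset_adjoin _ _ ⟨.inr ⟨c, hc⟩, rfl⟩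
  -- `u` is the translation `t ↦ t + x`; it fixes `L`, which is algebraic over `k(B)`.
  obtain ⟨u, hu, hut⟩ := htB'.exists_algEquiv_affine 1 (fun i ↦ (x i : F)) fun i ↦
    isAlgebraic_algebraMap (⟨x i, IntermediateField.subset_adjoin _ _ (hxB i)⟩ :
      IntermediateField.adjoin k B)
  -- `σ` is the reflection `t ↦ s - t = x`; it fixes all elements algebraic over `K = k(s, C)`, in
  -- particular `u T`.
  obtain ⟨σ, hσ, hσt⟩ := htK.exists_algEquiv_affine (-1) s fun i ↦
    isAlgebraic_algebraMap (⟨s i, hsK i⟩ : K)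
  let u' : F ≃ₐ[k] F := u.restrictScalars k
  let σ' : F ≃ₐ[k] F := σ.restrictScalars k
  have hu'L : u' ∈ L.fixingSubgroup := (IntermediateField.mem_fixingSubgroup_iff _ _).2
    fun a ha ↦ hu a (IntermediateField.isAlgebraic_adjoin_iff.2 (hLB a ha))
  have hu'T (a : F) (ha : a ∈ T) : IsAlgebraic K (u' a) := by
    refine (hTC a ha).algEquiv_apply_of_mapsTo u' ?_
    rintro b (hb | hb)
    · rw [(IntermediateField.mem_fixingSubgroup_iff _ _).1 hu'L b (hBL (hCB hb))]
      exact hCK b hb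
    · have : u' b = s ⟨b, hb⟩ := (hut ⟨b, hb⟩).trans (by simp [s])
      exact this.symm ▸ hsK _
  have hσ'T (a : F) (ha : a ∈ T) : σ' a ∈ L := by
    refine hL _ ((hTC a ha).algEquiv_apply_of_mapsTo σ' ?_)
    rintro b (hb | hb)
    · have : σ' b = b := hσ b (isAlgebraic_algebraMap (⟨b, hCK b hb⟩ : K))
      exact this.symm ▸ hBL (hCB hb)
    · have : σ' b = x ⟨b, hb⟩ := (hσt ⟨b, hb⟩).trans (by simp [s])
      exact this.symm ▸ hxL _
  have hconj : u'⁻¹ * σ' * u' ∈ H := hTH (by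
    rw [mem_fixingSubgroup_iff]
    intro a ha
    have : σ' (u' a) = u' a := hσ _ (hu'T a ha)
    simp only [AlgEquiv.smul_def, AlgEquiv.mul_apply, this]
    exact u'.symm_apply_apply a)
  refine ⟨σ', ?_, hσ'T⟩
  have := H.mul_mem (H.mul_mem (hLH hu'L) hconj) (H.inv_mem (hLH hu'L))
  rwa [show u' * (u'⁻¹ * σ' * u') * u'⁻¹ = σ' by group] at this

theorem IntermediateField.trdeg_le_of_le {K L : IntermediateField k F} (h : K ≤ L) :
    Algebra.trdeg k K ≤ Algebra.trdeg k L :=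
  _root_.trdeg_le_of_injective (IntermediateField.inclusion h)
    (IntermediateField.inclusion_injective h)

theorem IntermediateField.mem_algebraicClosure_of_isAlgebraic (K : IntermediateField k F) (a : F)
    (ha : IsAlgebraic ((algebraicClosure K F).restrictScalars k) a) :
    a ∈ (algebraicClosure K F).restrictScalars k := by
  have ha' : IsAlgebraic (algebraicClosure K F) a := ha
  exact mem_algebraicClosure_iff.2 (ha'.restrictScalars K)

end FieldAutomorphisms

/-! ### Additivity of derived functors. -/

namespace CategoryTheory.Functor

variable {C D : Type*} [Category* C] [Category* D] [Abelian C] [HasInjectiveResolutions C]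
  [Abelian D]

instance rightDerived_additive (T : C ⥤ D) [T.Additive] (n : ℕ) : (T.rightDerived n).Additive where
  map_add {X Y f g} := by
    let I := injectiveResolution X
    let J := injectiveResolution Y
    have w (h : X ⟶ Y) := InjectiveResolution.desc_commutes h J I
    rw [T.rightDerived_map_eq n f (InjectiveResolution.desc f J I) (w f),
      T.rightDerived_map_eq n g (InjectiveResolution.desc g J I) (w g),
      T.rightDerived_map_eq n (f + g)
        (InjectiveResolution.desc f J I + InjectiveResolution.desc g J I)
        (by rw [Preadditive.comp_add, w, w, Functor.map_add, Preadditive.add_comp]),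
      Functor.map_add, Preadditive.add_comp, Preadditive.comp_add]

end CategoryTheory.Functor

/-! ### Lifting invariants and torsion in smooth cohomology. -/

section SmoothCohomology

variable {R : Type} [CommRing R] {k : Type v} {F : Type u} [Field k] [Field F] [Algebra k F]

theorem SmoothRep.surjective_of_epi {V W : SmoothRep R k F} (f : V ⟶ W) [Epi f] :
    Function.Surjective f.hom.hom := by
  have := (isSmoothRep R k F).preservesEpimorphisms_ι_of_isNormalMonoCategory
  exact (Rep.epi_iff_surjective f.hom).1 (inferInstanceAs (Epi ((isSmoothRep R k F).ι.map f)))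

/-- The kernel of `S.g` is itself smooth, so exactness up to refinements applies to its inclusion,
and epimorphisms of smooth representations are surjective. -/
theorem SmoothRep.exists_of_exact {S : ShortComplex (SmoothRep R k F)} (hS : S.Exact)
    (y : S.X₂.obj) (hy : S.g.hom.hom y = 0) : ∃ x : S.X₁.obj, S.f.hom.hom x = y := by
  let K : Submodule R S.X₂.obj := LinearMap.ker S.g.hom.hom.toLinearMap
  have hK (g : F ≃ₐ[k] F) : K ≤ K.comap (S.X₂.obj.ρ g) := fun z hz ↦ by
    have hz' : S.g.hom.hom z = 0 := hz
    change S.g.hom.hom (S.X₂.obj.ρ g z) = 0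
    rw [Rep.hom_comm_apply, hz', map_zero]
  let i := Rep.subtype S.X₂.obj K hK
  let A : SmoothRep R k F :=
    ⟨S.X₂.obj.subrepresentation K hK,
      isSmoothRep_of_injective i Subtype.val_injective S.X₂.property⟩
  let a : A ⟶ S.X₂ := (isSmoothRep R k F).homMk i
  have ha : a ≫ S.g = 0 := by
    apply (isSmoothRep R k F).ι.map_injective
    ext z
    exact z.2
  obtain ⟨A', π, _, x, hx⟩ := S.exact_iff_exact_up_to_refinements.1 hS a ha
  obtain ⟨z, hz⟩ := SmoothRep.surjective_of_epi π ⟨y, hy⟩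
  refine ⟨x.hom.hom z, ?_⟩
  have h1 : (π ≫ a).hom.hom z = (x ≫ S.f).hom.hom z := by rw [hx]
  have h2 : (π ≫ a).hom.hom z = a.hom.hom (π.hom.hom z) := rfl
  have h3 : (x ≫ S.f).hom.hom z = S.f.hom.hom (x.hom.hom z) := rfl
  rw [← h3, ← h1, h2, hz]
  rfl

/-- Suppose that every invariant vector in the image of a morphism of smooth representations has a
multiple, by a natural number satisfying `P`, that is the image of an invariant vector. Then every
class in positive degree is killed by a natural number satisfying `P`. -/
theorem smoothCohomology_exists_nsmul_eq_zero (H : Subgroup (F ≃ₐ[k] F)) {P : ℕ → Prop}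
    (hH : ∀ {V W : SmoothRep R k F} (f : V ⟶ W) (v : V.obj),
      (∀ g ∈ H, W.obj.ρ g (f.hom.hom v) = f.hom.hom v) →
      ∃ N, P N ∧ ∃ v' : V.obj, (∀ g ∈ H, V.obj.ρ g v' = v') ∧
        f.hom.hom v' = N • f.hom.hom v)
    (W : SmoothRep R k F) (n : ℕ) (c : (smoothCohomology R H (n + 1)).obj W) :
    ∃ N, P N ∧ N • c = 0 := by
  let I : InjectiveResolution W := (HasInjectiveResolution.out (Z := W)).some
  let Z := ((smoothInvariants R H).mapHomologicalComplex (ComplexShape.up ℕ)).obj I.cocomplex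
  let e : (smoothCohomology R H (n + 1)).obj W ≅ Z.homology (n + 1) :=
    I.isoRightDerivedObj (smoothInvariants R H) (n + 1)
  have hc (d : Z.homology (n + 1)) : ∃ N, P N ∧ N • d = 0 := by
    have hepi : Function.Surjective (Z.homologyπ (n + 1)) :=
      (ModuleCat.epi_iff_surjective _).1 inferInstance
    obtain ⟨z, rfl⟩ := hepi d
    obtain ⟨⟨w, hw⟩, hzw⟩ : ∃ w, Z.iCycles (n + 1) z = w := ⟨_, rfl⟩
    have hdw : Z.d (n + 1) (n + 2) (Z.iCycles (n + 1) z) = 0 := by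
      rw [← ConcreteCategory.comp_apply, Z.iCycles_d]; rfl
    rw [hzw] at hdw
    -- The invariant cocycle `w` bounds some `y`, perhaps not invariant; `hH` then makes a multiple
    -- of `w` bound an invariant `y'`.
    obtain ⟨y, hy⟩ := SmoothRep.exists_of_exact (I.exact_succ n) w (congr_arg Subtype.val hdw)
    change (I.cocomplex.d n (n + 1)).hom.hom y = w at hy
    obtain ⟨N, hN, y', hy', hyy'⟩ := hH (I.cocomplex.d n (n + 1)) y
      fun g hg ↦ by rw [hy]; exact hw ⟨g, hg⟩
    refine ⟨N, hN, ?_⟩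
    let y'' : Z.X n := ⟨y', fun g ↦ hy' g g.2⟩
    have hz : N • z = Z.toCycles n (n + 1) y'' := by
      refine (ModuleCat.mono_iff_injective (Z.iCycles (n + 1))).1 inferInstance ?_
      rw [← ConcreteCategory.comp_apply, Z.toCycles_i, map_nsmul, hzw]
      refine Subtype.ext (Eq.symm ?_)
      exact hyy'.trans (by rw [hy]; rfl)
    rw [← map_nsmul, hz, ← ConcreteCategory.comp_apply, Z.toCycles_comp_homologyπ]
    rfl
  obtain ⟨N, hN, h⟩ := hc (e.hom c)
  refine ⟨N, hN, ?_⟩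
  refine (ModuleCat.mono_iff_injective e.hom).1 inferInstance ?_
  rw [map_nsmul, h, map_zero]

/-- By additivity, the map induced by `f` inverts multiplication by `N` on cohomology. -/
theorem smoothCohomology_eq_zero_of_nsmul_eq_zero (H : Subgroup (F ≃ₐ[k] F)) (n N : ℕ)
    {W : SmoothRep R k F} (f : W ⟶ W) (hf : N • f = 𝟙 W) (c : (smoothCohomology R H n).obj W)
    (hc : N • c = 0) : c = 0 := by
  have : (smoothCohomology R H n).Additive :=
    inferInstanceAs ((smoothInvariants R H).rightDerived n).Additive
  have h : N • (smoothCohomology R H n).map f = 𝟙 _ := by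
    rw [← Functor.map_nsmul, hf, CategoryTheory.Functor.map_id]
  calc
    c = (N • (smoothCohomology R H n).map f) c := by rw [h]; rfl
    _ = (smoothCohomology R H n).map f (N • c) := by rw [map_nsmul]; rfl
    _ = 0 := by rw [hc, map_zero]

theorem SmoothRep.exists_nsmul_tensorTrivial_eq_id (W : SmoothRep R k F) {M : Type}
    [AddCommGroup M] [Module R M] {N : ℕ} (m : M →ₗ[R] M) (hm : ∀ q, N • m q = q) :
    ∃ f : W.tensorTrivial M ⟶ W.tensorTrivial M, N • f = 𝟙 _ := by
  let φ : (W.tensorTrivial M).obj ⟶ (W.tensorTrivial M).obj :=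
    Rep.ofHom ⟨LinearMap.lTensor W.obj m, fun g ↦ TensorProduct.ext' fun w q ↦ rfl⟩
  refine ⟨(isSmoothRep R k F).homMk φ, ?_⟩
  apply (isSmoothRep R k F).ι.map_injective
  rw [Functor.map_nsmul]
  change N • φ = 𝟙 _
  ext x
  suffices h : N • LinearMap.lTensor W.obj m = LinearMap.id from LinearMap.congr_fun h x
  refine TensorProduct.ext' fun w q ↦ ?_
  change N • (w ⊗ₜ[R] m q) = w ⊗ₜ q
  rw [← TensorProduct.tmul_smul, hm]

theorem SmoothRep.exists_nsmul_eq_id_rat (W : SmoothRep ℚ k F) {N : ℕ} (hN : N ≠ 0) :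
    ∃ f : W ⟶ W, N • f = 𝟙 W := by
  refine ⟨(isSmoothRep ℚ k F).homMk ((N : ℚ)⁻¹ • 𝟙 W.obj), ?_⟩
  apply (isSmoothRep ℚ k F).ι.map_injective
  rw [Functor.map_nsmul]
  change N • ((N : ℚ)⁻¹ • 𝟙 W.obj) = 𝟙 W.obj
  rw [← Nat.cast_smul_eq_nsmul ℚ, smul_smul, mul_inv_cancel₀ (Nat.cast_ne_zero.2 hN), one_smul]

theorem SmoothRep.exists_fixed_of_fixingSubgroup [IsAlgClosed F] (L : IntermediateField k F)
    (hL : ∀ a : F, IsAlgebraic L a → a ∈ L) (hinf : Cardinal.aleph0 ≤ Algebra.trdeg k L)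
    {V W : SmoothRep R k F} (f : V ⟶ W) (v : V.obj)
    (hv : ∀ g ∈ L.fixingSubgroup, W.obj.ρ g (f.hom.hom v) = f.hom.hom v) :
    ∃ (v' : V.obj) (T : Finset F), f.hom.hom v' = f.hom.hom v ∧ (T : Set F) ⊆ L ∧
      ∀ g ∈ fixingSubgroup (F ≃ₐ[k] F) (T : Set F), V.obj.ρ g v' = v' := by
  classical
  obtain ⟨S, hS⟩ := V.property v
  -- The stabilizer of the image of `v`: moving `v` by an element of `H` does not change its image.
  let H : Subgroup (F ≃ₐ[k] F) :=
    { carrier := {g | W.obj.ρ g (f.hom.hom v) = f.hom.hom v}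
      one_mem' := by simp
      mul_mem' := fun {a b} (ha : _ = _) (hb : _ = _) ↦ by
        change W.obj.ρ (a * b) _ = _
        rw [map_mul, Module.End.mul_apply, hb, ha]
      inv_mem' := fun {a} (ha : _ = _) ↦ by
        change W.obj.ρ a⁻¹ _ = _
        nth_rw 1 [← ha]
        rw [← Module.End.mul_apply, ← map_mul, inv_mul_cancel, map_one, Module.End.one_apply] }
  obtain ⟨g, hg, hgS⟩ := exists_mem_forall_apply_mem_of_fixingSubgroup_le L hL hinf S
    S.finite_toSet H hv fun g hg ↦ by
      change W.obj.ρ g _ = _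
      rw [← Rep.hom_comm_apply, hS g hg]
  refine ⟨V.obj.ρ g v, S.image g, (Rep.hom_comm_apply _ _ _).trans hg, ?_, fun h hh ↦ ?_⟩
  · simpa [Set.subset_def] using hgS
  · have hfix : V.obj.ρ (g⁻¹ * h * g) v = v := hS _ (by
      simp only [mem_fixingSubgroup_iff, Finset.coe_image, Set.mem_image, AlgEquiv.smul_def]
        at hh ⊢
      intro y hy
      rw [AlgEquiv.mul_apply, AlgEquiv.mul_apply, hh _ ⟨y, hy, rfl⟩]
      exact g.symm_apply_apply y)
    rw [← Module.End.mul_apply, ← map_mul, show h * g = g * (g⁻¹ * h * g) by group, map_mul,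
      Module.End.mul_apply, hfix]

/-- Each `a ∈ T` can only move among the roots of its minimal polynomial over `K`. -/
theorem IntermediateField.finite_range_fixingSubgroup_apply (K : IntermediateField k F)
    (T : Finset F) (hT : ∀ a ∈ T, IsAlgebraic K a) :
    (Set.range fun (g : K.fixingSubgroup) (a : T) ↦ (g : F ≃ₐ[k] F) a).Finite := by
  refine (Set.Finite.pi' fun a : T ↦ ((minpoly K (a : F)).rootSet_finite F)).subset ?_
  rintro _ ⟨g, rfl⟩ a
  have hint := (hT a a.2).isIntegral
  refine (Polynomial.mem_rootSet_of_ne (minpoly.ne_zero hint)).2 ?_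
  let g' := K.fixingSubgroupEquiv g
  have := Polynomial.aeval_algHom_apply (g' : F →ₐ[K] F) (a : F) (minpoly K (a : F))
  rw [minpoly.aeval, map_zero] at this
  exact this

/-- The orbit of `v` is finite, since `g v` depends only on the restriction of `g` to `T`. Take `v'`
to be the orbit sum and `N` the orbit size. -/
theorem SmoothRep.exists_nsmul_fixed (K : IntermediateField k F)
    {V W : SmoothRep R k F} (f : V ⟶ W) (v : V.obj) (T : Finset F)
    (hT : ∀ a ∈ T, IsAlgebraic K a)
    (hTv : ∀ g ∈ fixingSubgroup (F ≃ₐ[k] F) (T : Set F), V.obj.ρ g v = v)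
    (hv : ∀ g ∈ K.fixingSubgroup, W.obj.ρ g (f.hom.hom v) = f.hom.hom v) :
    ∃ N : ℕ, N ≠ 0 ∧ ∃ v' : V.obj, (∀ g ∈ K.fixingSubgroup, V.obj.ρ g v' = v') ∧
      f.hom.hom v' = N • f.hom.hom v := by
  classical
  have hfin : (Set.range fun g : K.fixingSubgroup ↦ V.obj.ρ g v).Finite := by
    have hfac : (fun g : K.fixingSubgroup ↦ V.obj.ρ g v).FactorsThrough
        fun (g : K.fixingSubgroup) (a : T) ↦ (g : F ≃ₐ[k] F) a := fun g h hgh ↦ by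
      have hfix : V.obj.ρ ((h : F ≃ₐ[k] F)⁻¹ * g) v = v := hTv _ (by
        rw [mem_fixingSubgroup_iff]
        intro a ha
        have : (g : F ≃ₐ[k] F) a = (h : F ≃ₐ[k] F) a := congr_fun hgh ⟨a, ha⟩
        rw [AlgEquiv.smul_def, AlgEquiv.mul_apply, this]
        exact (h : F ≃ₐ[k] F).symm_apply_apply a)
      change V.obj.ρ g v = V.obj.ρ h v
      nth_rw 2 [← hfix]
      rw [← Module.End.mul_apply, ← map_mul, mul_inv_cancel_left]
    obtain ⟨e, he⟩ := (Function.factorsThrough_iff _).1 hfac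
    rw [he, Set.range_comp]
    exact (K.finite_range_fixingSubgroup_apply T hT).image e
  refine ⟨hfin.toFinset.card, ?_, ∑ w ∈ hfin.toFinset, w, fun g hg ↦ ?_, ?_⟩
  · rw [Finset.card_ne_zero]
    exact ⟨V.obj.ρ (1 : K.fixingSubgroup) v, hfin.mem_toFinset.2 ⟨1, rfl⟩⟩
  · rw [map_sum]
    refine Finset.sum_bijective (V.obj.ρ g) (V.obj.ρ.apply_bijective g) (fun w ↦ ?_) fun _ _ ↦ rfl
    simp only [Set.Finite.mem_toFinset, Set.mem_range]
    constructor
    · rintro ⟨h, rfl⟩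
      exact ⟨⟨g, hg⟩ * h, by simp⟩
    · rintro ⟨h, hh⟩
      refine ⟨⟨g, hg⟩⁻¹ * h, (V.obj.ρ.apply_bijective g).injective ?_⟩
      rw [← hh, ← Module.End.mul_apply, ← map_mul]
      simp
  · rw [map_sum]
    refine Finset.sum_eq_card_nsmul fun w hw ↦ ?_
    obtain ⟨g, rfl⟩ := hfin.mem_toFinset.1 hw
    exact (Rep.hom_comm_apply _ _ _).trans (hv g g.2)

end SmoothCohomology

/-! ### Vanishing theorems. -/

section Vanishing

variable {R : Type} [CommRing R] {k : Type v} {F : Type u} [Field k] [Field F] [Algebra k F]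
  [IsAlgClosed F]

theorem isZero_smoothCohomology_fixingSubgroup (L : IntermediateField k F)
    (hL : ∀ a : F, IsAlgebraic L a → a ∈ L) (hinf : Cardinal.aleph0 ≤ Algebra.trdeg k L)
    (W : SmoothRep R k F) {n : ℕ} (hn : 0 < n) :
    IsZero ((smoothCohomology R L.fixingSubgroup n).obj W) := by
  obtain ⟨n, rfl⟩ := Nat.exists_eq_succ_of_ne_zero hn.ne'
  have hzero (c : (smoothCohomology R L.fixingSubgroup (n + 1)).obj W) : c = 0 := by
    -- Over a closed `L` the lift needs no multiple, so the annihilating integer can be taken to be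
    -- `1`.
    obtain ⟨N, rfl, hN⟩ := smoothCohomology_exists_nsmul_eq_zero L.fixingSubgroup
      (P := fun N ↦ N = 1) (fun f v hv ↦ by
        obtain ⟨v', T, hfv, hTL, hT⟩ := SmoothRep.exists_fixed_of_fixingSubgroup L hL hinf f v hv
        refine ⟨1, rfl, v', fun g hg ↦ hT g ?_, by rw [hfv, one_smul]⟩
        exact (mem_fixingSubgroup_iff _).2 fun a ha ↦
          (IntermediateField.mem_fixingSubgroup_iff _ _).1 hg a (hTL ha)) W n c
    rwa [one_smul] at hN
  exact ModuleCat.isZero_of_iff_subsingleton.2 ⟨fun a b ↦ (hzero a).trans (hzero b).symm⟩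

theorem smoothCohomology_fixingSubgroup_exists_nsmul_eq_zero (K : IntermediateField k F)
    (hinf : Cardinal.aleph0 ≤ Algebra.trdeg k K) (W : SmoothRep R k F) (n : ℕ)
    (c : (smoothCohomology R K.fixingSubgroup (n + 1)).obj W) : ∃ N : ℕ, N ≠ 0 ∧ N • c = 0 :=
  smoothCohomology_exists_nsmul_eq_zero K.fixingSubgroup (fun f v hv ↦ by
    let L : IntermediateField k F := (algebraicClosure K F).restrictScalars k
    have hKL : K ≤ L := fun a ha ↦ (algebraicClosure K F).algebraMap_mem ⟨a, ha⟩
    obtain ⟨v', T, hfv, hTL, hT⟩ := SmoothRep.exists_fixed_of_fixingSubgroup L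
      (K.mem_algebraicClosure_of_isAlgebraic) (hinf.trans (IntermediateField.trdeg_le_of_le hKL)) f v
      fun g hg ↦ hv g (IntermediateField.fixingSubgroup_le hKL hg)
    obtain ⟨N, hN, v'', hv'', hfv''⟩ := SmoothRep.exists_nsmul_fixed K f v' T
      (fun a ha ↦ mem_algebraicClosure_iff.1 (hTL ha)) hT (hfv.symm ▸ hv)
    exact ⟨N, hN, v'', hv'', hfv ▸ hfv''⟩) W n c

theorem isZero_smoothCohomology_fixingSubgroup_of_nsmul (K : IntermediateField k F)
    (hinf : Cardinal.aleph0 ≤ Algebra.trdeg k K) (W : SmoothRep R k F)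
    (hW : ∀ N : ℕ, N ≠ 0 → ∃ f : W ⟶ W, N • f = 𝟙 W) {n : ℕ} (hn : 0 < n) :
    IsZero ((smoothCohomology R K.fixingSubgroup n).obj W) := by
  obtain ⟨n, rfl⟩ := Nat.exists_eq_succ_of_ne_zero hn.ne'
  have hzero (c : (smoothCohomology R K.fixingSubgroup (n + 1)).obj W) : c = 0 := by
    obtain ⟨N, hN, hc⟩ := smoothCohomology_fixingSubgroup_exists_nsmul_eq_zero K hinf W n c
    obtain ⟨f, hf⟩ := hW N hN
    exact smoothCohomology_eq_zero_of_nsmul_eq_zero _ _ N f hf c hc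
  exact ModuleCat.isZero_of_iff_subsingleton.2 ⟨fun a b ↦ (hzero a).trans (hzero b).symm⟩

end Vanishing

theorem mainTheorem7 {k : Type v} {F : Type u} [Field k] [CharZero k] [Field F] [Algebra k F]
    [IsAlgClosed F] (hF : Algebra.trdeg k F ≤ Cardinal.aleph0)
    (F' : IntermediateField k F) (hF' : Cardinal.aleph0 ≤ Algebra.trdeg k F') :
    (∀ (W : SmoothRep ℤ k F) (n : ℕ), 0 < n →
      IsZero ((smoothCohomology ℤ
        ((algebraicClosure F' F).restrictScalars k).fixingSubgroup n).obj W) ∧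
      IsZero ((smoothCohomology ℤ F'.fixingSubgroup n).obj (W.tensorTrivial ℚ))) ∧
    (∀ (W : SmoothRep ℚ k F) (n : ℕ), 0 < n →
      IsZero ((smoothCohomology ℚ
        ((algebraicClosure F' F).restrictScalars k).fixingSubgroup n).obj W) ∧
      IsZero ((smoothCohomology ℚ F'.fixingSubgroup n).obj W)) := by
  have hL : ∀ a : F, IsAlgebraic ((algebraicClosure F' F).restrictScalars k) a →
      a ∈ (algebraicClosure F' F).restrictScalars k := F'.mem_algebraicClosure_of_isAlgebraic
  have hinf : Cardinal.aleph0 ≤ Algebra.trdeg k ((algebraicClosure F' F).restrictScalars k) :=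
    hF'.trans (IntermediateField.trdeg_le_of_le fun a ha ↦ (algebraicClosure F' F).algebraMap_mem ⟨a, ha⟩)
  refine ⟨fun W n hn ↦ ⟨isZero_smoothCohomology_fixingSubgroup _ hL hinf W hn,
    isZero_smoothCohomology_fixingSubgroup_of_nsmul F' hF' _ (fun N hN ↦
      W.exists_nsmul_tensorTrivial_eq_id
        ((LinearMap.mulLeft ℚ (N : ℚ)⁻¹).restrictScalars ℤ) fun q ↦ ?_) hn⟩,
    fun W n hn ↦ ⟨isZero_smoothCohomology_fixingSubgroup _ hL hinf W hn,
      isZero_smoothCohomology_fixingSubgroup_of_nsmul F' hF' W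
        (fun N hN ↦ W.exists_nsmul_eq_id_rat hN) hn⟩⟩
  change N • ((N : ℚ)⁻¹ * q) = q
  rw [nsmul_eq_mul, mul_inv_cancel_left₀ (Nat.cast_ne_zero.2 hN)]
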